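/- Let $E$ be a real Banach lattice. Say that * $a\in E$ is an atom if $a>0$ and the order ideal generated by $a$ consists only of scalar multiples of $a$; $E$ is atomic if for every $x>0$ in $E$ there is an atom $a$ with $a\le x$; * $E$ is a KB-space if every increasing norm bounded sequence of positive elements of $E$ is norm convergent; * a sequence $(x_n)$ in $E$ is $uaw$-null if, for every $u\ge 0$ in $E$, $|x_n|\wedge u\to 0$ weakly; * $(x_n)$ is Cesàro convergent if its arithmetic means $\frac1m\sum_{k=1}^m x_k$ converge in norm to some element of $E$ as $m\to\infty$; * $E$ has the Banach–Saks property if every norm bounded sequence in $E$ has a Cesàro convergent subsequence; * $E$ has the unbounded Banach–Saks property if every norm bounded $uaw$-null sequence in $E$ has a Cesàro convergent subsequence. If $E$ is an atomic KB-space with the unbounded Banach–Saks property, then $E$ has the Banach–Saks property. -/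

import Mathlib

open Filter Topology

namespace BanachLattice

/-- `a` is an atom: `a > 0` and the order ideal generated by `a` consists only of the scalar
multiples of `a`. -/
def IsAtomElement {E : Type*} [AddCommGroup E] [Module ℝ E] [Lattice E] (a : E) : Prop :=
  0 < a ∧ ∀ x : E, (∃ t : ℝ, |x| ≤ t • a) → ∃ c : ℝ, x = c • a

/-- The vector lattice `E` is atomic: every `x > 0` dominates an atom. -/
def IsAtomicLattice (E : Type*) [AddCommGroup E] [Module ℝ E] [Lattice E] : Prop :=
  ∀ x : E, 0 < x → ∃ a : E, IsAtomElement a ∧ a ≤ x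

/-- The sequence `x` is norm bounded. -/
def NormBounded {E : Type*} [NormedAddCommGroup E] (x : ℕ → E) : Prop :=
  ∃ C : ℝ, ∀ n, ‖x n‖ ≤ C

/-- The defining property of a KB-space: every increasing norm bounded sequence of positive
elements is norm convergent. -/
def IsKBSpace (E : Type*) [NormedAddCommGroup E] [Lattice E] : Prop :=
  ∀ x : ℕ → E, Monotone x → (∀ n, 0 ≤ x n) → NormBounded x → ∃ y : E, Tendsto x atTop (𝓝 y)

/-- Unbounded absolute weak convergence of `x` to `y` along the filter `l`:
`|x i - y| ⊓ u → 0` weakly for every `u ≥ 0`. -/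
def UAWTendsto {E ι : Type*} [NormedAddCommGroup E] [NormedSpace ℝ E] [Lattice E]
    (x : ι → E) (l : Filter ι) (y : E) : Prop :=
  ∀ u : E, 0 ≤ u → ∀ f : StrongDual ℝ E, Tendsto (fun i => f (|x i - y| ⊓ u)) l (𝓝 0)

/-- The Cesàro means of `x` converge in norm. -/
def CesaroConvergent {E : Type*} [NormedAddCommGroup E] [NormedSpace ℝ E] (x : ℕ → E) : Prop :=
  ∃ y : E, Tendsto (fun n : ℕ => (1 / ((n : ℝ) + 1)) • ∑ k ∈ Finset.range (n + 1), x k)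
    atTop (𝓝 y)

/-- The Banach–Saks property. -/
def HasBSP (E : Type*) [NormedAddCommGroup E] [NormedSpace ℝ E] : Prop :=
  ∀ x : ℕ → E, NormBounded x → ∃ φ : ℕ → ℕ, StrictMono φ ∧ CesaroConvergent (x ∘ φ)

/-- The unbounded Banach–Saks property. -/
def HasUBSP (E : Type*) [NormedAddCommGroup E] [NormedSpace ℝ E] [Lattice E] : Prop :=
  ∀ x : ℕ → E, NormBounded x → UAWTendsto x atTop 0 →
    ∃ φ : ℕ → ℕ, StrictMono φ ∧ CesaroConvergent (x ∘ φ)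

end BanachLattice

open BanachLattice Filter Topology

/-! ### Inequalities for truncations. -/

section VectorLattice

variable {E : Type*} [AddCommGroup E] [Lattice E] [IsOrderedAddMonoid E]

/-! It suffices that every bounded sequence has a subsequence converging to some `y` in unbounded
norm: subtracting `y` makes it `uaw`-null, the hypothesis applies, and adding `y` back only shifts
the Cesàro means.

For the subsequence, treat positive and negative parts separately. Given a bounded `p n ≥ 0`,
`exists_monotone_isCompact_Icc` gives increasing `z k` with compact order intervals, and a diagonal
(Tychonoff) argument makes `p n ⊓ z k` converge to `y k` for all `k` at once. The `y k` increase and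
are bounded, so the KB property gives a limit `q`. It is the unbounded norm limit because, by
atomicity, only truncations at multiples of atoms need checking
(`unboundedNormTendsto_of_tendsto_inf_nsmul`). -/

lemma inf_add_le_inf_add_inf {x y z : E} (hx : 0 ≤ x) (hy : 0 ≤ y) (hz : 0 ≤ z) :
    x ⊓ (y + z) ≤ x ⊓ y + x ⊓ z := by
  rw [inf_add, add_inf, add_inf]
  refine le_inf (le_inf ?_ ?_) (le_inf ?_ ?_)
  · exact inf_le_left.trans (le_add_of_nonneg_left hx)
  · exact inf_le_left.trans (le_add_of_nonneg_right hz)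
  · exact inf_le_left.trans (le_add_of_nonneg_left hy)
  · exact inf_le_right

lemma inf_nsmul_le_nsmul_inf {x y : E} (hx : 0 ≤ x) (hy : 0 ≤ y) (n : ℕ) :
    x ⊓ n • y ≤ n • (x ⊓ y) := by
  induction n with
  | zero => simp
  | succ n ih =>
    rw [succ_nsmul, succ_nsmul]
    exact (inf_add_le_inf_add_inf hx (nsmul_nonneg hy n) hy).trans (by gcongr)

lemma abs_add_inf_le {x y z : E} (hz : 0 ≤ z) : |x + y| ⊓ z ≤ |x| ⊓ z + |y| ⊓ z := by
  refine (inf_le_inf_right z (abs_add_le x y)).trans ?_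
  simpa only [inf_comm] using inf_add_le_inf_add_inf hz (abs_nonneg x) (abs_nonneg y)

lemma nsmul_inf_nsmul_eq_zero {u a : E} (hu : 0 ≤ u) (ha : 0 ≤ a) (h : u ⊓ a = 0) (m n : ℕ) :
    (m • u) ⊓ (n • a) = 0 := by
  refine le_antisymm ?_ (le_inf (nsmul_nonneg hu m) (nsmul_nonneg ha n))
  refine (inf_nsmul_le_nsmul_inf (nsmul_nonneg hu m) ha n).trans ?_
  have : (m • u) ⊓ a ≤ 0 := by
    rw [inf_comm]
    refine (inf_nsmul_le_nsmul_inf ha hu m).trans ?_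
    rw [inf_comm, h, smul_zero]
  exact (nsmul_le_nsmul_right this n).trans (by simp)

end VectorLattice

/-! ### Scalar multiples of an atom. -/

section Atoms

variable {E : Type*} [AddCommGroup E] [Module ℝ E] [Lattice E] [IsOrderedAddMonoid E]

lemma BanachLattice.IsAtomElement.exists_eq_smul {a x : E} (ha : IsAtomElement a) {t : ℝ}
    (h0 : 0 ≤ x) (hx : x ≤ t • a) : ∃ c : ℝ, x = c • a :=
  ha.2 x ⟨t, by rwa [abs_of_nonneg h0]⟩

lemma BanachLattice.IsAtomElement.smul_le_smul_iff [IsOrderedModule ℝ E] {a : E}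
    (ha : IsAtomElement a) {s t : ℝ} :
    s • a ≤ t • a ↔ s ≤ t := by
  refine ⟨fun h => ?_, fun h => smul_le_smul_of_nonneg_right h ha.1.le⟩
  by_contra! hts
  have h1 : (s - t) • a ≤ 0 := by rw [sub_smul]; exact sub_nonpos.mpr h
  have h2 := smul_le_smul_of_nonneg_left h1 (inv_nonneg.mpr (sub_pos.mpr hts).le)
  rw [smul_zero, inv_smul_smul₀ (sub_pos.mpr hts).ne'] at h2
  exact not_lt_of_ge h2 ha.1

end Atoms

/-! ### Exhausting positive elements from within. -/

section Exhaustion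

variable {E : Type*} [NormedAddCommGroup E] [Lattice E] [HasSolidNorm E] [IsOrderedAddMonoid E]

lemma norm_le_norm_of_nonneg_of_le {x y : E} (hx : 0 ≤ x) (hxy : x ≤ y) : ‖x‖ ≤ ‖y‖ :=
  norm_le_norm_of_abs_le_abs (by rwa [abs_of_nonneg hx, abs_of_nonneg (hx.trans hxy)])

lemma tendsto_zero_of_nonneg_of_le {x y : ℕ → E} (hx : ∀ n, 0 ≤ x n) (hxy : ∀ n, x n ≤ y n)
    (hy : Tendsto y atTop (𝓝 0)) : Tendsto x atTop (𝓝 0) :=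
  squeeze_zero_norm (fun n => norm_le_norm_of_nonneg_of_le (hx n) (hxy n))
    (by simpa using hy.norm)

/-- In a KB-space, an upward directed family of elements of `[0, v]` is Cauchy. -/
lemma exists_forall_norm_sub_lt_of_isKBSpace (hKB : IsKBSpace E) {D : Set E} {v : E}
    (hD : ∀ w ∈ D, 0 ≤ w ∧ w ≤ v) {w₀ : E} (hw₀ : w₀ ∈ D) {ε : ℝ} (hε : 0 < ε) :
    ∃ w ∈ D, w₀ ≤ w ∧ ∀ w' ∈ D, w ≤ w' → ‖w' - w‖ < ε := by
  by_contra! hcon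
  choose! g hgD hg hgε using hcon
  -- Iterating the failure gives an increasing bounded sequence with jumps at least `ε`, which
  -- cannot converge.
  let s : ℕ → {w // w ∈ D ∧ w₀ ≤ w} := fun n =>
    Nat.rec ⟨w₀, hw₀, le_rfl⟩
      (fun _ w => ⟨g w.1, hgD _ w.2.1 w.2.2, w.2.2.trans (hg _ w.2.1 w.2.2)⟩) n
  have hs : ∀ n, (s (n + 1)).1 = g (s n).1 := fun n => rfl
  have hmono : Monotone fun n => (s n).1 := monotone_nat_of_le_succ fun n => by
    rw [hs]; exact hg _ (s n).2.1 (s n).2.2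
  obtain ⟨y, hy⟩ := hKB _ hmono (fun n => (hD _ (s n).2.1).1)
    ⟨‖v‖, fun n => norm_le_norm_of_nonneg_of_le (hD _ (s n).2.1).1 (hD _ (s n).2.1).2⟩
  have hdiff := ((hy.comp (tendsto_add_atTop_nat 1)).sub hy).norm
  rw [sub_self, norm_zero] at hdiff
  obtain ⟨n, hn⟩ := (hdiff.eventually_lt_const hε).exists
  have := hgε _ (s n).2.1 (s n).2.2
  simp only [Function.comp_apply, hs] at hn
  exact absurd hn (not_lt.mpr this)

/-- If a set of positive elements of an atomic KB-space is additive, solid and contains all atoms,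
then every positive element is the limit of an increasing sequence in this set. -/
lemma exists_monotone_tendsto_of_isAtomicLattice [NormedSpace ℝ E]
    (hatomic : IsAtomicLattice E) (hKB : IsKBSpace E) {T : Set E} (h0 : 0 ∈ T)
    (hadd : ∀ w ∈ T, ∀ w' ∈ T, 0 ≤ w → 0 ≤ w' → w + w' ∈ T)
    (hsolid : ∀ w ∈ T, ∀ w', 0 ≤ w' → w' ≤ w → w' ∈ T)
    (hatom : ∀ a, IsAtomElement a → a ∈ T) {v : E} (hv : 0 ≤ v) :
    ∃ w : ℕ → E, Monotone w ∧ (∀ n, w n ∈ T ∧ 0 ≤ w n ∧ w n ≤ v) ∧ Tendsto w atTop (𝓝 v) := by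
  let D : Set E := {w | w ∈ T ∧ 0 ≤ w ∧ w ≤ v}
  have hD : ∀ w ∈ D, 0 ≤ w ∧ w ≤ v := fun w hw => hw.2
  have hsup : ∀ w ∈ D, ∀ w' ∈ D, w ⊔ w' ∈ D := fun w hw w' hw' =>
    ⟨hsolid _ (hadd w hw.1 w' hw'.1 hw.2.1 hw'.2.1) _ (hw.2.1.trans le_sup_left)
      (sup_le (le_add_of_nonneg_right hw'.2.1) (le_add_of_nonneg_left hw.2.1)),
      hw.2.1.trans le_sup_left, sup_le hw.2.2 hw'.2.2⟩
  have hstep : ∀ (n : ℕ), ∀ w₀ ∈ D, ∃ w ∈ D, w₀ ≤ w ∧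
      ∀ w' ∈ D, w ≤ w' → ‖w' - w‖ < 1 / ((n : ℝ) + 1) := fun n w₀ hw₀ =>
    exists_forall_norm_sub_lt_of_isKBSpace hKB hD hw₀ (by positivity)
  choose! g hgD hg hgε using hstep
  let s : ℕ → {w // w ∈ D} := fun n =>
    Nat.rec ⟨0, h0, le_rfl, hv⟩ (fun k w => ⟨g k w.1, hgD k _ w.2⟩) n
  have hs : ∀ n, (s (n + 1)).1 = g n (s n).1 := fun n => rfl
  have hmono : Monotone fun n => (s n).1 := monotone_nat_of_le_succ fun n => by
    rw [hs]; exact hg n _ (s n).2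
  obtain ⟨y, hy⟩ := hKB _ hmono (fun n => (s n).2.2.1)
    ⟨‖v‖, fun n => norm_le_norm_of_nonneg_of_le (s n).2.2.1 (s n).2.2.2⟩
  -- Joining `w` to the sequence moves its terms by at most `1 / (n + 1)`, so `w ⊔ y = y`.
  have hyub : ∀ w ∈ D, w ≤ y := by
    intro w hw
    have hlim : Tendsto (fun n => w ⊔ (s (n + 1)).1 - (s (n + 1)).1) atTop (𝓝 0) := by
      refine squeeze_zero_norm (fun n => ?_) tendsto_one_div_add_atTop_nhds_zero_nat
      exact (hgε n _ (s n).2 _ (hsup w hw _ (s (n + 1)).2) le_sup_right).le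
    have hy1 := hy.comp (tendsto_add_atTop_nat 1)
    have := tendsto_nhds_unique hlim ((tendsto_const_nhds.sup_nhds hy1).sub hy1)
    rw [eq_comm, sub_eq_zero] at this
    exact this ▸ le_sup_left
  have hyv : y ≤ v := le_of_tendsto' hy fun n => (s n).2.2.2
  refine ⟨fun n => (s n).1, hmono, fun n => (s n).2, ?_⟩
  rcases hyv.eq_or_lt with h | h
  · rwa [h] at hy
  -- An atom in the gap could be added to every term without leaving `D`; in the limit `y + a ≤ y`.
  obtain ⟨a, ha, hay⟩ := hatomic (v - y) (sub_pos.mpr h)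
  have hbound : ∀ n, (s n).1 + a ≤ y := fun n => by
    refine hyub _ ⟨hadd _ (s n).2.1 _ (hatom a ha) (s n).2.2.1 ha.1.le,
      add_nonneg (s n).2.2.1 ha.1.le, ?_⟩
    calc (s n).1 + a ≤ y + (v - y) := add_le_add (hyub _ (s n).2) hay
      _ = v := by abel
  have := le_of_tendsto' (hy.add_const a) hbound
  exact absurd ((add_le_iff_nonpos_right y).mp this) (not_le_of_gt ha.1)

end Exhaustion

/-! ### Compact order intervals and remainders off an atom. -/

section Compact

variable {E : Type*} [NormedAddCommGroup E] [Lattice E] [HasSolidNorm E] [IsOrderedAddMonoid E]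

/-- Riesz decomposition puts the interval inside the Minkowski sum of the two given ones. -/
lemma isCompact_Icc_add {w w' : E} (hw : 0 ≤ w) (hw' : 0 ≤ w')
    (h : IsCompact (Set.Icc 0 w)) (h' : IsCompact (Set.Icc 0 w')) :
    IsCompact (Set.Icc 0 (w + w')) := by
  refine (h.add h').of_isClosed_subset isClosed_Icc fun x hx => ?_
  refine Set.mem_add.mpr ⟨x - x ⊓ w', ⟨sub_nonneg.mpr inf_le_left, ?_⟩, x ⊓ w',
    ⟨le_inf hx.1 hw', inf_le_right⟩, by abel⟩
  rw [sub_le_iff_le_add, add_inf]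
  exact le_inf (le_add_of_nonneg_left hw) hx.2

lemma isCompact_Icc_nsmul {w : E} (hw : 0 ≤ w) (h : IsCompact (Set.Icc 0 w)) (n : ℕ) :
    IsCompact (Set.Icc 0 (n • w)) := by
  induction n with
  | zero => simp
  | succ n ih =>
    rw [succ_nsmul]
    exact isCompact_Icc_add (nsmul_nonneg hw n) hw ih h

variable [NormedSpace ℝ E] [IsOrderedModule ℝ E]

lemma isCompact_Icc_of_isAtomElement {a : E} (ha : IsAtomElement a) :
    IsCompact (Set.Icc 0 a) := by
  have hc : IsCompact ((fun c : ℝ => c • a) '' Set.Icc 0 1) :=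
    isCompact_Icc.image (by fun_prop)
  refine hc.of_isClosed_subset isClosed_Icc fun x hx => ?_
  obtain ⟨c, rfl⟩ := ha.exists_eq_smul (t := 1) hx.1 (by simpa using hx.2)
  refine ⟨c, ⟨?_, ?_⟩, rfl⟩
  · rw [← ha.smul_le_smul_iff, zero_smul]; exact hx.1
  · rw [← ha.smul_le_smul_iff, one_smul]; exact hx.2

/-- A positive element whose multiple of an atom is capped above the norm leaves a remainder
disjoint from the atom. -/
lemma sub_inf_nsmul_inf_eq_zero {a x : E} (ha : IsAtomElement a) (hx : 0 ≤ x) {M : ℕ}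
    (hM : ‖x‖ < M * ‖a‖) : (x - x ⊓ M • a) ⊓ a = 0 := by
  have ha0 := ha.1.le
  have hr : 0 ≤ x - x ⊓ M • a := sub_nonneg.mpr inf_le_left
  simp only [← Nat.cast_smul_eq_nsmul ℝ] at *
  obtain ⟨m, hm⟩ := ha.exists_eq_smul (le_inf hx (smul_nonneg M.cast_nonneg ha0)) inf_le_right
  obtain ⟨t, ht⟩ := ha.exists_eq_smul (x := (x - x ⊓ (M : ℝ) • a) ⊓ a) (t := 1)
    (le_inf hr ha0) (by simp)
  have hge : 0 ≤ (x - x ⊓ (M : ℝ) • a) ⊓ a := le_inf hr ha0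
  refine le_antisymm ?_ hge
  rw [ht]
  by_contra hcon
  have ht0 : 0 < t := by
    by_contra! h
    exact hcon (by simpa using (ha.smul_le_smul_iff (t := 0)).mpr h)
  have hle : (t + m) • a ≤ x := by
    rw [add_smul, ← ht, ← hm, ← le_sub_iff_add_le]; exact inf_le_left
  -- Either `(t + m) • a` lies below the truncation `m • a`, against `t > 0`, or `M • a ≤ x`,
  -- against the norm bound.
  rcases le_total (t + m) M with h | h
  · have h1 : (t + m) • a ≤ m • a := hm ▸ le_inf hle (ha.smul_le_smul_iff.mpr h)
    have := ha.smul_le_smul_iff.mp h1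
    linarith
  · have h1 : (M : ℝ) • a ≤ x := (ha.smul_le_smul_iff.mpr h).trans hle
    have h2 := norm_le_norm_of_nonneg_of_le (smul_nonneg M.cast_nonneg ha0) h1
    rw [norm_smul, Real.norm_natCast] at h2
    linarith

end Compact

/-! ### Testing unbounded norm convergence on atoms. -/

section UnboundedNormConvergence

variable {E : Type*} [NormedAddCommGroup E] [Lattice E]

/-- Unbounded norm convergence of the sequence `x` to `y`: `|x n - y| ⊓ v → 0` in norm for every
`v ≥ 0`. -/
def UnboundedNormTendsto (x : ℕ → E) (y : E) : Prop :=
  ∀ v : E, 0 ≤ v → Tendsto (fun n => |x n - y| ⊓ v) atTop (𝓝 0)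

lemma UnboundedNormTendsto.comp {x : ℕ → E} {y : E} (h : UnboundedNormTendsto x y) {φ : ℕ → ℕ}
    (hφ : StrictMono φ) : UnboundedNormTendsto (x ∘ φ) y := fun v hv =>
  (h v hv).comp hφ.tendsto_atTop

variable [HasSolidNorm E] [IsOrderedAddMonoid E]

lemma UnboundedNormTendsto.sub {x x' : ℕ → E} {y y' : E} (h : UnboundedNormTendsto x y)
    (h' : UnboundedNormTendsto x' y') :
    UnboundedNormTendsto (fun n => x n - x' n) (y - y') := by
  intro v hv
  refine tendsto_zero_of_nonneg_of_le (fun n => le_inf (abs_nonneg _) hv) (fun n => ?_)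
    (by simpa using (h v hv).add (h' v hv))
  have : x n - x' n - (y - y') = (x n - y) + -(x' n - y') := by abel
  simpa only [this, abs_neg] using abs_add_inf_le (x := x n - y) (y := -(x' n - y')) hv

variable [NormedSpace ℝ E]

/-- In an atomic KB-space, unbounded norm convergence may be tested on atoms. -/
lemma unboundedNormTendsto_of_forall_isAtomElement (hatomic : IsAtomicLattice E)
    (hKB : IsKBSpace E) {x : ℕ → E} {y : E}
    (h : ∀ a, IsAtomElement a → Tendsto (fun n => |x n - y| ⊓ a) atTop (𝓝 0)) :
    UnboundedNormTendsto x y := by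
  intro v hv
  let T : Set E := {w | Tendsto (fun n => |x n - y| ⊓ w) atTop (𝓝 0)}
  obtain ⟨w, -, hw, hwv⟩ := exists_monotone_tendsto_of_isAtomicLattice hatomic hKB (T := T)
    (by simp [T])
    (fun w hw w' hw' h0 h0' => tendsto_zero_of_nonneg_of_le
      (fun n => le_inf (abs_nonneg _) (add_nonneg h0 h0'))
      (fun n => inf_add_le_inf_add_inf (abs_nonneg _) h0 h0') (by simpa using Tendsto.add hw hw'))
    (fun w hw w' h0 hle => tendsto_zero_of_nonneg_of_le (fun n => le_inf (abs_nonneg _) h0)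
      (fun n => inf_le_inf_left _ hle) hw) h hv
  rw [Metric.tendsto_atTop]
  intro ε hε
  obtain ⟨k, hk⟩ := ((Metric.tendsto_nhds.mp hwv) (ε / 2) (half_pos hε)).exists
  obtain ⟨N, hN⟩ := Metric.tendsto_atTop.mp (hw k).1 (ε / 2) (half_pos hε)
  refine ⟨N, fun n hn => ?_⟩
  have h1 := hN n hn
  -- Replacing `v` by `w k` costs at most `‖v - w k‖`, uniformly in `n`.
  have h2 := norm_inf_sub_inf_le_norm v (w k) |x n - y|
  rw [inf_comm v, inf_comm (w k)] at h2
  rw [dist_zero_right] at h1 ⊢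
  rw [dist_comm, dist_eq_norm] at hk
  calc ‖|x n - y| ⊓ v‖ = ‖(|x n - y| ⊓ v - |x n - y| ⊓ w k) + |x n - y| ⊓ w k‖ := by
        rw [sub_add_cancel]
    _ < ε := by linarith [norm_add_le (|x n - y| ⊓ v - |x n - y| ⊓ w k) (|x n - y| ⊓ w k)]

/-- For norm bounded positive sequences, unbounded norm convergence follows from convergence of all
truncations by multiples of atoms. -/
lemma unboundedNormTendsto_of_tendsto_inf_nsmul [IsOrderedModule ℝ E] (hatomic : IsAtomicLattice E)
    (hKB : IsKBSpace E) {p : ℕ → E} {q : E} (hp : ∀ n, 0 ≤ p n) (hq : 0 ≤ q) (hb : NormBounded p)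
    (h : ∀ a, IsAtomElement a → ∀ M : ℕ,
      Tendsto (fun n => p n ⊓ M • a) atTop (𝓝 (q ⊓ M • a))) :
    UnboundedNormTendsto p q := by
  refine unboundedNormTendsto_of_forall_isAtomElement hatomic hKB fun a ha => ?_
  obtain ⟨C, hC⟩ := hb
  have hanorm : 0 < ‖a‖ := norm_pos_iff.mpr ha.1.ne'
  -- One `M` serves `q` and all `p n`, so every remainder past `M • a` is disjoint from `a`.
  obtain ⟨M, hM⟩ := exists_nat_gt ((|C| + ‖q‖) / ‖a‖)
  rw [div_lt_iff₀ hanorm] at hM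
  have hpM : ∀ n, ‖p n‖ < M * ‖a‖ := fun n => by
    linarith [hC n, le_abs_self C, norm_nonneg q]
  have hqM : ‖q‖ < M * ‖a‖ := by linarith [abs_nonneg C]
  have hlim : Tendsto (fun n => |p n ⊓ M • a - q ⊓ M • a|) atTop (𝓝 0) := by
    have := ((h a ha M).sub_const (q ⊓ M • a)).norm
    rw [sub_self, norm_zero] at this
    rw [tendsto_zero_iff_norm_tendsto_zero]
    simpa only [norm_abs_eq_norm] using this
  refine tendsto_zero_of_nonneg_of_le (fun n => le_inf (abs_nonneg _) ha.1.le) (fun n => ?_) hlim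
  have hdecomp : p n - q = (p n ⊓ M • a - q ⊓ M • a) +
      ((p n - p n ⊓ M • a) + -(q - q ⊓ M • a)) := by abel
  calc |p n - q| ⊓ a
      ≤ |p n ⊓ M • a - q ⊓ M • a| ⊓ a +
        (|p n - p n ⊓ M • a| ⊓ a + |-(q - q ⊓ M • a)| ⊓ a) := by
        rw [hdecomp]
        exact (abs_add_inf_le ha.1.le).trans (add_le_add le_rfl (abs_add_inf_le ha.1.le))
    _ = |p n ⊓ M • a - q ⊓ M • a| ⊓ a := by
        rw [abs_neg, abs_of_nonneg (sub_nonneg.mpr inf_le_left),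
          abs_of_nonneg (sub_nonneg.mpr inf_le_left),
          sub_inf_nsmul_inf_eq_zero ha (hp n) (hpM n), sub_inf_nsmul_inf_eq_zero ha hq hqM,
          add_zero, add_zero]
    _ ≤ _ := inf_le_left

end UnboundedNormConvergence

/-! ### Extracting convergent subsequences. -/

section Subsequences

variable {E : Type*} [NormedAddCommGroup E] [NormedSpace ℝ E] [CompleteSpace E] [Lattice E]
  [HasSolidNorm E] [IsOrderedAddMonoid E] [IsOrderedModule ℝ E]

/-- The series `∑ 2⁻ⁿ p n` converges absolutely and dominates each of its terms. -/
lemma exists_forall_le_pow_nsmul {p : ℕ → E} (hp : ∀ n, 0 ≤ p n) (hb : NormBounded p) :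
    ∃ u : E, 0 ≤ u ∧ ∀ n, p n ≤ 2 ^ n • u := by
  obtain ⟨C, hC⟩ := hb
  have hsum : Summable fun n => (1 / 2 : ℝ) ^ n • p n := by
    refine Summable.of_norm_bounded (summable_geometric_two.mul_right C) fun n => ?_
    rw [norm_smul, norm_pow, Real.norm_of_nonneg (by norm_num : (0 : ℝ) ≤ 1 / 2)]
    gcongr
    exact hC n
  have hnn : ∀ n, 0 ≤ (1 / 2 : ℝ) ^ n • p n := fun n => smul_nonneg (by positivity) (hp n)
  refine ⟨∑' n, (1 / 2 : ℝ) ^ n • p n, tsum_nonneg hnn, fun n => ?_⟩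
  have h := le_hasSum hsum.hasSum n fun j _ => hnn j
  have h2 := nsmul_le_nsmul_right h (2 ^ n)
  rwa [← Nat.cast_smul_eq_nsmul ℝ, smul_smul, Nat.cast_pow, ← mul_pow,
    (by norm_num : ((2 : ℕ) : ℝ) * (1 / 2) = 1), one_pow, one_smul] at h2

/-- For every norm bounded positive sequence `p` there is an increasing sequence `z` of elements with
compact order intervals that exhausts the truncations of all `p n` at multiples of atoms. -/
lemma exists_monotone_isCompact_Icc (hatomic : IsAtomicLattice E) (hKB : IsKBSpace E)
    {p : ℕ → E} (hp : ∀ n, 0 ≤ p n) (hb : NormBounded p) :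
    ∃ z : ℕ → E, Monotone z ∧ (∀ k, 0 ≤ z k) ∧ (∀ k, IsCompact (Set.Icc 0 (z k))) ∧
      ∀ a, IsAtomElement a → ∀ M : ℕ, ∃ k₀, ∀ k ≥ k₀, ∀ n,
        p n ⊓ M • a = p n ⊓ z k ⊓ M • a := by
  obtain ⟨u, hu, hpu⟩ := exists_forall_le_pow_nsmul hp hb
  obtain ⟨w, hmono, hw, hwu⟩ := exists_monotone_tendsto_of_isAtomicLattice hatomic hKB
    (T := {w | IsCompact (Set.Icc 0 w)}) (by simp)
    (fun w hw w' hw' h0 h0' => isCompact_Icc_add h0 h0' hw hw')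
    (fun w hw w' h0 hle => hw.of_isClosed_subset isClosed_Icc (Set.Icc_subset_Icc_right hle))
    (fun a ha => isCompact_Icc_of_isAtomElement ha) hu
  have hz0 : ∀ k, 0 ≤ k • w k := fun k => nsmul_nonneg (hw k).2.1 k
  -- The factor `k` lets `z k` eventually exceed any multiple of an atom that meets some `w k`; an
  -- atom meeting none is disjoint from `u`, hence from all `p n`.
  refine ⟨fun k => k • w k, fun i j hij => (nsmul_le_nsmul_right (hmono hij) i).trans
    (nsmul_le_nsmul_left (hw j).2.1 hij), hz0, fun k => isCompact_Icc_nsmul (hw k).2.1 (hw k).1 k,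
    fun a ha M => ?_⟩
  have hMa : 0 ≤ M • a := nsmul_nonneg ha.1.le M
  by_cases hall : ∀ k, w k ⊓ a = 0
  · have hua : u ⊓ a = 0 := tendsto_nhds_unique (hwu.inf_nhds tendsto_const_nhds) (by simp [hall])
    have hpa : ∀ n, p n ⊓ M • a = 0 := fun n =>
      le_antisymm ((inf_le_inf_right _ (hpu n)).trans
        (nsmul_inf_nsmul_eq_zero hu ha.1.le hua _ M).le) (le_inf (hp n) hMa)
    refine ⟨0, fun k _ n => ?_⟩
    rw [hpa n, inf_right_comm, hpa n, inf_eq_left.mpr (hz0 k)]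
  · push Not at hall
    obtain ⟨k₁, hk₁⟩ := hall
    have hnn : 0 ≤ w k₁ ⊓ a := le_inf (hw k₁).2.1 ha.1.le
    obtain ⟨c, hc⟩ := ha.exists_eq_smul (t := 1) hnn (by simp)
    have hc0 : 0 < c := by
      by_contra! h
      refine hk₁ (le_antisymm ?_ hnn)
      rw [hc]
      simpa using (ha.smul_le_smul_iff (t := 0)).mpr h
    obtain ⟨K, hK⟩ := exists_nat_ge (M / c)
    refine ⟨max k₁ K, fun k hk n => ?_⟩
    have hKk : (M : ℝ) ≤ k * c := by
      rw [div_le_iff₀ hc0] at hK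
      have : (K : ℝ) ≤ k := by exact_mod_cast (le_max_right _ _).trans hk
      nlinarith
    have hle : M • a ≤ k • w k := calc
      M • a ≤ k • (w k₁ ⊓ a) := by
        rw [hc, ← Nat.cast_smul_eq_nsmul ℝ, ← Nat.cast_smul_eq_nsmul ℝ, smul_smul,
          ha.smul_le_smul_iff]
        exact hKk
      _ ≤ k • w k := nsmul_le_nsmul_right
        (inf_le_left.trans (hmono ((le_max_left _ _).trans hk))) k
    rw [inf_assoc, inf_eq_right.mpr hle]

/-- In an atomic KB-space, every norm bounded positive sequence has an unbounded norm convergent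
subsequence. -/
lemma exists_subseq_unboundedNormTendsto_of_nonneg (hatomic : IsAtomicLattice E)
    (hKB : IsKBSpace E) {p : ℕ → E} (hp : ∀ n, 0 ≤ p n) (hb : NormBounded p) :
    ∃ (q : E) (φ : ℕ → ℕ), StrictMono φ ∧ UnboundedNormTendsto (p ∘ φ) q := by
  obtain ⟨z, hmono, hz0, hcomp, hz⟩ := exists_monotone_isCompact_Icc hatomic hKB hp hb
  obtain ⟨C, hC⟩ := hb
  obtain ⟨y, -, φ, hφ, hlim⟩ := (isCompact_univ_pi hcomp).tendsto_subseq
    (x := fun n k => p n ⊓ z k) fun n k _ => ⟨le_inf (hp n) (hz0 k), inf_le_right⟩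
  rw [tendsto_pi_nhds] at hlim
  have hy0 : ∀ k, 0 ≤ y k := fun k => ge_of_tendsto' (hlim k) fun n => le_inf (hp _) (hz0 k)
  obtain ⟨q, hq⟩ := hKB y
    (fun i j hij => le_of_tendsto_of_tendsto' (hlim i) (hlim j) fun n =>
      inf_le_inf_left _ (hmono hij)) hy0
    ⟨C, fun k => le_of_tendsto' (hlim k).norm fun n =>
      (norm_le_norm_of_nonneg_of_le (le_inf (hp _) (hz0 k)) inf_le_left).trans (hC _)⟩
  refine ⟨q, φ, hφ, unboundedNormTendsto_of_tendsto_inf_nsmul hatomic hKB (fun n => hp _)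
    (ge_of_tendsto' hq hy0) ⟨C, fun n => hC _⟩ fun a ha M => ?_⟩
  obtain ⟨k₀, hk₀⟩ := hz a ha M
  -- The left side does not involve `k`, so `y k ⊓ M • a` is constant from `k₀` on and equals `q ⊓ M
  -- • a`.
  have htrunc : ∀ k ≥ k₀, Tendsto (fun n => p (φ n) ⊓ M • a) atTop (𝓝 (y k ⊓ M • a)) :=
    fun k hk => by
      simp only [hk₀ k hk]
      exact (hlim k).inf_nhds tendsto_const_nhds
  have hconst : Tendsto (fun k => y k ⊓ M • a) atTop (𝓝 (y k₀ ⊓ M • a)) :=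
    tendsto_const_nhds.congr' ((eventually_ge_atTop k₀).mono fun k hk =>
      tendsto_nhds_unique (htrunc k₀ le_rfl) (htrunc k hk))
  rw [tendsto_nhds_unique (hq.inf_nhds tendsto_const_nhds) hconst]
  exact htrunc k₀ le_rfl

/-- In an atomic KB-space, every norm bounded sequence has an unbounded norm convergent
subsequence. -/
lemma exists_subseq_unboundedNormTendsto (hatomic : IsAtomicLattice E)
    (hKB : IsKBSpace E) {x : ℕ → E} (hb : NormBounded x) :
    ∃ (y : E) (φ : ℕ → ℕ), StrictMono φ ∧ UnboundedNormTendsto (x ∘ φ) y := by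
  obtain ⟨C, hC⟩ := hb
  have hpos : ∀ n, ‖(x n)⁺‖ ≤ C := fun n => by
    refine (norm_le_norm_of_abs_le_abs ?_).trans (hC n)
    rw [abs_of_nonneg (posPart_nonneg _)]
    exact sup_le (le_abs_self _) (abs_nonneg _)
  have hneg : ∀ n, ‖(x n)⁻‖ ≤ C := fun n => by
    refine (norm_le_norm_of_abs_le_abs ?_).trans (hC n)
    rw [abs_of_nonneg (negPart_nonneg _)]
    exact sup_le (neg_le_abs _) (abs_nonneg _)
  obtain ⟨q, φ, hφ, hq⟩ := exists_subseq_unboundedNormTendsto_of_nonneg hatomic hKB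
    (p := fun n => (x n)⁺) (fun n => posPart_nonneg _) ⟨C, hpos⟩
  obtain ⟨r, ψ, hψ, hr⟩ := exists_subseq_unboundedNormTendsto_of_nonneg hatomic hKB
    (p := fun n => (x (φ n))⁻) (fun n => negPart_nonneg _) ⟨C, fun n => hneg _⟩
  refine ⟨q - r, φ ∘ ψ, hφ.comp hψ, ?_⟩
  simpa only [Function.comp_def, posPart_sub_negPart] using (hq.comp hψ).sub hr

end Subsequences

/-! ### Passage to Cesàro means. -/

lemma UnboundedNormTendsto.uawTendsto {E : Type*} [NormedAddCommGroup E] [NormedSpace ℝ E]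
    [Lattice E] {x : ℕ → E} {y : E} (h : UnboundedNormTendsto x y) :
    UAWTendsto (fun n => x n - y) atTop 0 := fun u hu f => by
  simpa [Function.comp_def] using (f.continuous.tendsto 0).comp (h u hu)

lemma BanachLattice.CesaroConvergent.of_sub_const {E : Type*} [NormedAddCommGroup E]
    [NormedSpace ℝ E] {x : ℕ → E} {y : E} (h : CesaroConvergent fun n => x n - y) :
    CesaroConvergent x := by
  obtain ⟨l, hl⟩ := h
  refine ⟨l + y, (hl.add_const y).congr fun n => ?_⟩
  have : ((n : ℝ) + 1) ≠ 0 := by positivity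
  rw [Finset.sum_sub_distrib, Finset.sum_const, Finset.card_range, smul_sub,
    ← Nat.cast_smul_eq_nsmul ℝ, smul_smul, Nat.cast_add_one, one_div, inv_mul_cancel₀ this,
    one_smul, sub_add_cancel]

theorem mainTheorem12 (E : Type*) [NormedAddCommGroup E] [NormedSpace ℝ E] [CompleteSpace E]
    [Lattice E] [HasSolidNorm E] [IsOrderedAddMonoid E] [IsOrderedModule ℝ E]
    (hatomic : BanachLattice.IsAtomicLattice E) (hKB : BanachLattice.IsKBSpace E)
    (hUBSP : BanachLattice.HasUBSP E) :
    BanachLattice.HasBSP E := by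
  intro x hx
  obtain ⟨y, φ, hφ, hy⟩ := exists_subseq_unboundedNormTendsto hatomic hKB hx
  obtain ⟨C, hC⟩ := hx
  obtain ⟨ψ, hψ, hces⟩ := hUBSP (fun n => x (φ n) - y)
    ⟨C + ‖y‖, fun n => (norm_sub_le _ _).trans (add_le_add (hC _) le_rfl)⟩ hy.uawTendsto
  exact ⟨φ ∘ ψ, hφ.comp hψ, hces.of_sub_const⟩
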